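/- **Setting.** Let $\Phi_\ell(x,\alpha)=x^\ell-\sum_{j=1}^{\ell-1}c_jx^j-\alpha$ with real constants $c_1,\dots,c_{\ell-1}$. Let $\alpha_1\neq\alpha_2$ be real and, for $k=1,2$, let $\kappa[\alpha_k]=(\kappa_1[\alpha_k]<\dots<\kappa_{m_k}[\alpha_k])$ be a finite set of distinct real roots of $\Phi_\ell(x,\alpha_k)=0$, listed increasingly. (The two sets are disjoint because $\alpha_1\ne\alpha_2$.) **Totally nonnegative Grassmannian.** A real $n\times m$ matrix $A$ of rank $n$ represents the point of $\mathrm{Gr}(n,m)$ given by its row space. For $I=\{i_1<\dots<i_n\}\subseteq\{1,\dots,m\}$, $\Delta_I(A)$ is the $n\times n$ minor on the columns $I$. We say that $A$ is totally nonnegative, $A\in\mathrm{Gr}(n,m)_{\ge0}$, if its row space has a representing matrix all of whose nonzero maximal minors are positive. (If $A$ is in reduced row echelon form, this says that $A$ itself has no negative maximal minor.) **Permutation and chord diagram.** For $A\in\mathrm{Gr}(n,m)_{\ge0}$ with columns $A_1,\dots,A_m$, let $\pi(A)\in S_m$ be the permutation that labels the positroid cell of $A$ (and describes the asymptotic line solitons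 of the KP soliton of $A$): $\pi(A)(i)=i$ if $A_i=0$ or if $A_i$ is not in the span of the other columns, and otherwise $\pi(A)(i)=j$ is the unique index $j\neq i$ such that, with indices taken cyclically modulo $m$, $A_i$ is in the span of $A_j,A_{j+1},\dots,A_{i-1}$ but not in the span of $A_{j+1},\dots,A_{i-1}$. Given points $\kappa_1<\dots<\kappa_m$ on a line, the chord diagram of $\pi$ has an upper chord joining $\kappa_i$ and $\kappa_{\pi(i)}$ for each $i$ with $i<\pi(i)$, and a lower chord joining $\kappa_i$ and $\kappa_{\pi(i)}$ for each $i$ with $\pi(i)<i$. Two chords on the same side of the line, with end points $a<b$ and $c<d$, cross if $a<c<b<d$ or $c<a<d<b$. **$\kappa$-direct sum.** Let $A[\alpha_k]$ be an $n_k\times m_k$ matrix whose columns are attached, in order, to the points of $\kappa[\alpha_k]$. The matrices $A[\alpha_1]$ and $A[\alpha_2]$ are *non-crossing* if no chord of the chord diagram of $\pi(A[\alpha_1])$ on the points $\kappa[\alpha_1]$ crosses a chord of that of $\pi(A[\alpha_2])$ on the points $\kappa[\alpha_2]$, both drawn on the same line. The $\kappa$-direct sum $A[\alpha_1]\hat\oplus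 A[\alpha_2]$ is the point of $\mathrm{Gr}(n_1+n_2,m_1+m_2)$ represented by the block diagonal matrix $\begin{pmatrix}A[\alpha_1]&0\\0&A[\alpha_2]\end{pmatrix}$ with its columns rearranged in the increasing order of the attached points of $\kappa[\alpha_1]\cup\kappa[\alpha_2]$. **Proposition.** If $A[\alpha_1]\in\mathrm{Gr}(n_1,m_1)_{\ge0}$ and $A[\alpha_2]\in\mathrm{Gr}(n_2,m_2)_{\ge0}$ with $\alpha_1\ne\alpha_2$ are not non-crossing, then $A[\alpha_1]\hat\oplus A[\alpha_2]$ is not totally nonnegative. -/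

import Mathlib

namespace KPSoliton

/-- The spectral curve `Φ_ℓ(x, α) = x ^ ℓ - ∑_{j=1}^{ℓ-1} c_j x ^ j - α`, a deformation of
`x ^ ℓ - α` with deformation parameters `c_1, …, c_{ℓ-1}`. -/
def spectralCurve (ℓ : ℕ) (c : ℕ → ℝ) (x α : ℝ) : ℝ :=
  x ^ ℓ - ∑ j ∈ Finset.Icc 1 (ℓ - 1), c j * x ^ j - α

section Grassmannian

variable {n m : ℕ}

/-- The `n × n` minor `Δ_I(A)` on the columns `I = {i_1 < ⋯ < i_n}`. -/
noncomputable def minor (A : Matrix (Fin n) (Fin m) ℝ) (I : Fin n ↪o Fin m) : ℝ :=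
  (A.submatrix id I).det

/-- `A` represents a point of the totally nonnegative Grassmannian `Gr(n, m)_{≥ 0}`: it has full
rank `n`, and some matrix with the same row space (every such matrix is `g * A` with `g`
invertible) has all its nonzero maximal minors positive. For a matrix in reduced row echelon form
the pivot minor is `1`, and one may take `g = 1`. -/
def IsTotallyNonnegative (A : Matrix (Fin n) (Fin m) ℝ) : Prop :=
  A.rank = n ∧ ∃ g : GL (Fin n) ℝ, ∀ I : Fin n ↪o Fin m,
    minor ((g : Matrix (Fin n) (Fin n) ℝ) * A) I ≠ 0 →
      0 < minor ((g : Matrix (Fin n) (Fin n) ℝ) * A) I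

end Grassmannian

section Permutation

variable {n m : ℕ}

/-- The column index reached from `i` after `d ≤ m` cyclic steps to the left. -/
def stepBack (i : Fin m) (d : ℕ) : Fin m :=
  ⟨(i.val + m - d) % m, Nat.mod_lt _ i.pos⟩

/-- The span of the `e` columns of `A` that cyclically precede the column `i`. -/
def precedingSpan (A : Matrix (Fin n) (Fin m) ℝ) (i : Fin m) (e : ℕ) :
    Submodule ℝ (Fin n → ℝ) :=
  Submodule.span ℝ {v | ∃ d, 1 ≤ d ∧ d ≤ e ∧ v = A.col (stepBack i d)}

theorem precedingSpan_mono (A : Matrix (Fin n) (Fin m) ℝ) (i : Fin m) {e e' : ℕ} (h : e ≤ e') :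
    precedingSpan A i e ≤ precedingSpan A i e' := by
  apply Submodule.span_mono
  rintro v ⟨d, h1, h2, rfl⟩
  exact ⟨d, h1, h2.trans h, rfl⟩

theorem stepBack_zero (i : Fin m) : stepBack i 0 = i := by
  ext; simp [stepBack, Nat.mod_eq_of_lt i.isLt]

theorem stepBack_self (i : Fin m) : stepBack i m = i := by
  ext; simp [stepBack, Nat.mod_eq_of_lt i.isLt]

theorem exists_mem_precedingSpan (A : Matrix (Fin n) (Fin m) ℝ) (i : Fin m) :
    ∃ e, A.col i ∈ precedingSpan A i e :=
  ⟨m, Submodule.subset_span ⟨m, i.pos, le_rfl, by rw [stepBack_self]⟩⟩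

open Classical in
/-- The least `e` for which the column `i` lies in the span of the `e` columns that cyclically
precede it. It is `0` for a zero column, and `m` for a column outside the span of all others. -/
noncomputable def backDistance (A : Matrix (Fin n) (Fin m) ℝ) (i : Fin m) : ℕ :=
  Nat.find (exists_mem_precedingSpan A i)

theorem mem_precedingSpan_backDistance (A : Matrix (Fin n) (Fin m) ℝ) (i : Fin m) :
    A.col i ∈ precedingSpan A i (backDistance A i) := by
  classical
  exact Nat.find_spec (exists_mem_precedingSpan A i)

theorem notMem_of_lt_backDistance (A : Matrix (Fin n) (Fin m) ℝ) (i : Fin m) {e : ℕ}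
    (h : e < backDistance A i) : A.col i ∉ precedingSpan A i e := by
  classical
  exact Nat.find_min (exists_mem_precedingSpan A i) h

theorem backDistance_le (A : Matrix (Fin n) (Fin m) ℝ) (i : Fin m) : backDistance A i ≤ m := by
  classical
  exact Nat.find_min' _
    (Submodule.subset_span ⟨m, i.pos, le_rfl, by rw [stepBack_self]⟩)

/-- The map underlying the permutation `π(A)`. -/
noncomputable def solitonMap (A : Matrix (Fin n) (Fin m) ℝ) (i : Fin m) : Fin m :=
  stepBack i (backDistance A i)

theorem eq_of_stepBack_eq {i k : Fin m} {e : ℕ} (he : e ≤ m) (h : stepBack i e = k) :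
    (k.val + e) % m = i.val := by
  subst h
  have hi := i.isLt
  simp only [stepBack, Nat.mod_add_mod]
  rw [show i.val + m - e + e = i.val + m by omega, Nat.add_mod_right, Nat.mod_eq_of_lt hi]

theorem stepBack_eq {i k : Fin m} {e d : ℕ} (he : e ≤ m) (hd : d ≤ e) (h : stepBack i e = k) :
    (stepBack i d).val = (k.val + (e - d)) % m := by
  have h1 := eq_of_stepBack_eq he h
  have hk := k.isLt
  simp only [stepBack]
  rw [← h1]
  rcases lt_or_ge (k.val + e) m with h2 | h2
  · rw [Nat.mod_eq_of_lt h2, show k.val + e + m - d = k.val + (e - d) + m by omega,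
      Nat.add_mod_right]
  · have h3 : (k.val + e) % m = k.val + e - m := by
      rw [Nat.mod_eq_sub_mod h2]
      exact Nat.mod_eq_of_lt (by omega)
    rw [h3, show k.val + e - m + m - d = k.val + (e - d) by omega]

theorem mem_pred_or (A : Matrix (Fin n) (Fin m) ℝ) (i : Fin m) (h : 0 < backDistance A i) :
    ∃ a : ℝ, ∃ z ∈ precedingSpan A i (backDistance A i - 1),
      A.col i = a • A.col (solitonMap A i) + z := by
  have h1 := mem_precedingSpan_backDistance A i
  have h2 : {v | ∃ d, 1 ≤ d ∧ d ≤ backDistance A i ∧ v = A.col (stepBack i d)} =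
      insert (A.col (solitonMap A i))
        {v | ∃ d, 1 ≤ d ∧ d ≤ backDistance A i - 1 ∧ v = A.col (stepBack i d)} := by
    ext v
    simp only [Set.mem_ofPred_eq, Set.mem_insert_iff]
    constructor
    · rintro ⟨d, hd1, hd2, rfl⟩
      rcases hd2.eq_or_lt with h3 | h3
      · left; rw [h3]; rfl
      · exact Or.inr ⟨d, hd1, by omega, rfl⟩
    · rintro (rfl | ⟨d, hd1, hd2, rfl⟩)
      · exact ⟨_, h, le_rfl, rfl⟩
      · exact ⟨d, hd1, by omega, rfl⟩
  rw [precedingSpan, h2, Submodule.mem_span_insert] at h1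
  exact h1

theorem col_solitonMap_ne_zero (A : Matrix (Fin n) (Fin m) ℝ) (i : Fin m)
    (h : 0 < backDistance A i) : A.col (solitonMap A i) ≠ 0 := by
  intro h0
  obtain ⟨a, z, hz, h1⟩ := mem_pred_or A i h
  rw [h0, smul_zero, zero_add] at h1
  exact notMem_of_lt_backDistance A i (Nat.sub_lt h one_pos) (h1 ▸ hz)

theorem col_eq_zero_of_backDistance (A : Matrix (Fin n) (Fin m) ℝ) (i : Fin m)
    (h : backDistance A i = 0) : A.col i = 0 := by
  have h1 := mem_precedingSpan_backDistance A i
  rw [h, precedingSpan] at h1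
  have h2 : {v : Fin n → ℝ | ∃ d, 1 ≤ d ∧ d ≤ 0 ∧ v = A.col (stepBack i d)} = ∅ := by
    ext v
    simp only [Set.mem_ofPred_eq, Set.mem_empty_iff_false, iff_false]
    rintro ⟨d, h3, h4, _⟩
    omega
  rw [h2, Submodule.span_empty, Submodule.mem_bot] at h1
  exact h1

theorem solitonMap_ne_of_lt (A : Matrix (Fin n) (Fin m) ℝ) (i j : Fin m)
    (hi : 0 < backDistance A i) (hij : backDistance A i < backDistance A j) :
    solitonMap A i ≠ solitonMap A j := by
  intro hk
  obtain ⟨a, z, hz, h1⟩ := mem_pred_or A i hi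
  obtain ⟨b, w, hw, h2⟩ := mem_pred_or A j (hi.trans hij)
  have hmi := backDistance_le A i
  have hmj := backDistance_le A j
  have key : ∀ d, d < backDistance A i →
      A.col (stepBack i d) ∈ precedingSpan A j (backDistance A j - 1) := by
    intro d hd
    refine Submodule.subset_span
      ⟨backDistance A j - (backDistance A i - d), by omega, by omega, ?_⟩
    congr 1
    ext
    rw [stepBack_eq hmi hd.le hk, stepBack_eq hmj (Nat.sub_le _ _) rfl]
    congr 2
    omega
  have hle : precedingSpan A i (backDistance A i - 1) ≤
      precedingSpan A j (backDistance A j - 1) := by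
    rw [precedingSpan, Submodule.span_le]
    rintro v ⟨d, _, hd, rfl⟩
    exact key d (by omega)
  have hai : A.col i ∈ precedingSpan A j (backDistance A j - 1) := by
    have := key 0 hi
    rwa [stepBack_zero] at this
  have ha : a ≠ 0 := by
    rintro rfl
    rw [zero_smul, zero_add] at h1
    exact notMem_of_lt_backDistance A i (Nat.sub_lt hi one_pos) (h1 ▸ hz)
  have hkm : A.col (solitonMap A i) ∈ precedingSpan A j (backDistance A j - 1) := by
    have h3 : a • A.col (solitonMap A i) ∈ precedingSpan A j (backDistance A j - 1) := by
      rw [show a • A.col (solitonMap A i) = A.col i - z by rw [h1]; abel]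
      exact Submodule.sub_mem _ hai (hle hz)
    exact (Submodule.smul_mem_iff _ ha).1 h3
  refine notMem_of_lt_backDistance A j (Nat.sub_lt (hi.trans hij) one_pos) ?_
  rw [h2, ← hk]
  exact Submodule.add_mem _ (Submodule.smul_mem _ _ hkm) hw

theorem solitonMap_injective (A : Matrix (Fin n) (Fin m) ℝ) :
    Function.Injective (solitonMap A) := by
  have h0 : ∀ i, backDistance A i = 0 → solitonMap A i = i := fun i h => by
    rw [solitonMap, h, stepBack_zero]
  intro i j hij
  rcases Nat.eq_zero_or_pos (backDistance A i) with hi | hi <;>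
    rcases Nat.eq_zero_or_pos (backDistance A j) with hj | hj
  · rw [← h0 i hi, hij, h0 j hj]
  · exact absurd (by rw [← hij, h0 i hi]; exact col_eq_zero_of_backDistance A i hi)
      (col_solitonMap_ne_zero A j hj)
  · exact absurd (by rw [hij, h0 j hj]; exact col_eq_zero_of_backDistance A j hj)
      (col_solitonMap_ne_zero A i hi)
  · rcases lt_trichotomy (backDistance A i) (backDistance A j) with h | h | h
    · exact absurd hij (solitonMap_ne_of_lt A i j hi h)
    · have h1 := eq_of_stepBack_eq (backDistance_le A i) hij
      have h2 := eq_of_stepBack_eq (backDistance_le A j) (rfl : _ = solitonMap A j)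
      ext
      rw [← h1, ← h2, h]
    · exact absurd hij.symm (solitonMap_ne_of_lt A j i hj h)

/-- The permutation `π(A) ∈ S_m` that labels the positroid cell of `A`. It sends `i` to the
index `j` such that the column `A_i` lies in the span of the cyclic run of columns
`A_j, A_{j+1}, …, A_{i-1}` but not in the span of `A_{j+1}, …, A_{i-1}`. It is the derangement that
describes the asymptotic line solitons: for example `A = (1, a, b)` with `a, b > 0` has
`1 ↦ 3 ↦ 2 ↦ 1`, that is, a `[1,3]`-soliton for `y ≫ 0` and `[1,2]`- and `[2,3]`-solitons for
`y ≪ 0`. A fixed point occurs only at a zero column, or at a column that is not in the span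
of the others (a row of the reduced row echelon form that has no nonzero entry but its pivot). It
depends on the row space of `A` only. -/
noncomputable def solitonPerm (A : Matrix (Fin n) (Fin m) ℝ) : Equiv.Perm (Fin m) :=
  Equiv.ofBijective (solitonMap A) (Finite.injective_iff_bijective.1 (solitonMap_injective A))

end Permutation

section Crossing

/-- Two chords on the same side of the line, joining `a < b` and `c < d`, cross. -/
def ChordsCross (a b c d : ℝ) : Prop :=
  (a < c ∧ c < b ∧ b < d) ∨ (c < a ∧ a < d ∧ d < b)

/-- The chord diagrams of two permutations `π` and `σ`, drawn on the points
`κ 0 < κ 1 < ⋯` and `μ 0 < μ 1 < ⋯` of one line, have no crossing between a chord of `π` and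
a chord of `σ`. An exceedance `i < π i` is a chord on the upper side of the line and a deficiency
`π i < i` a chord on the lower side. -/
def NonCrossing {m m' : ℕ} (κ : Fin m → ℝ) (μ : Fin m' → ℝ)
    (π : Equiv.Perm (Fin m)) (σ : Equiv.Perm (Fin m')) : Prop :=
  (∀ i j, i < π i → j < σ j → ¬ ChordsCross (κ i) (κ (π i)) (μ j) (μ (σ j))) ∧
  (∀ i j, π i < i → σ j < j → ¬ ChordsCross (κ (π i)) (κ i) (μ (σ j)) (μ j))

/-- Two matrices, with columns attached to the points of `κ` and of `μ`, are non-crossing. -/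
def NonCrossingMatrices {n n' m m' : ℕ} (κ : Fin m → ℝ) (μ : Fin m' → ℝ)
    (A : Matrix (Fin n) (Fin m) ℝ) (B : Matrix (Fin n') (Fin m') ℝ) : Prop :=
  NonCrossing κ μ (solitonPerm A) (solitonPerm B)

end Crossing

/-- The `κ`-direct sum of `A` and `B`, whose columns are attached to the points of `κ` and `μ`: the
columns of the block diagonal matrix with blocks `A`, `B` are put in the increasing order of all
the points. The rows of `A` come first; reordering them (to reach the reduced row echelon form when
`A` and `B` are in that form) does not change the point of the Grassmannian. -/
noncomputable def kappaDirectSum {n n' m m' : ℕ} (κ : Fin m → ℝ) (μ : Fin m' → ℝ)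
    (A : Matrix (Fin n) (Fin m) ℝ) (B : Matrix (Fin n') (Fin m') ℝ) :
    Matrix (Fin (n + n')) (Fin (m + m')) ℝ :=
  (Matrix.fromBlocks A 0 0 B).submatrix finSumFinEquiv.symm
    (fun k => finSumFinEquiv.symm (Tuple.sort (Fin.append κ μ) k))

end KPSoliton

/-! The obstruction is a sign count over four maximal minors. A chord from `i` to `π(i)` gives a
nonzero minor using column `i` that stays nonzero when `i` is exchanged for `π(i)`
(`exists_det_ne_zero_solitonPerm`). Given a chord of each summand, the two exchanges are made
independently, which yields four nonzero minors of the direct sum.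

With columns kept in block order, each of these is a minor of one summand times a minor of the
other, up to the common factor `det g`. Every factor occurs twice among the four, so their product
is positive. If the sum were totally nonnegative, each would have the sign of the permutation
sorting its columns, that is, of the Vandermonde determinant of the attached points
(`det_mul_det_vandermonde_pos`). In the product of the four Vandermonde determinants all differences
pair off except those between exchanged points. What remains is `(c - a) * (d - b) * (d - a) * (c -
b)`, which is negative when the chords cross. -/

namespace KPSoliton

/-! ### Column exchange along a chord -/

section ColumnExchange

variable {n m : ℕ}

/-- If the column `i` lies in `span W + ℝ A_j` but not in the span of the columns in `W`, then
`A` has a nonzero maximal minor using `i` that stays nonzero when `i` is replaced by `j`. -/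
theorem exists_det_ne_zero_exchange (A : Matrix (Fin n) (Fin m) ℝ) (hA : A.rank = n)
    {i j : Fin m} {W : Set (Fin m)} (hi : A.col i ∉ Submodule.span ℝ (A.col '' W))
    {a : ℝ} {z : Fin n → ℝ} (hz : z ∈ Submodule.span ℝ (A.col '' W))
    (hij : A.col i = a • A.col j + z) :
    ∃ (I : Fin n → Fin m) (p : Fin n), I p = i ∧ (A.submatrix id I).det ≠ 0 ∧
      (A.submatrix id (Function.update I p j)).det ≠ 0 := by
  -- Take a basis `b₀` of the span of `W`, adjoin `i`, and extend to a column basis `b` of the whole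
  -- space.
  obtain ⟨b₀, hb₀W, -, hWb₀, hb₀⟩ := exists_linearIndepOn_extension
    (K := ℝ) (v := A.col) (linearIndepOn_empty ℝ A.col) (Set.empty_subset W)
  have hspan : Submodule.span ℝ (A.col '' W) ≤ Submodule.span ℝ (A.col '' b₀) :=
    Submodule.span_le.2 hWb₀
  have hib₀ : A.col i ∉ Submodule.span ℝ (A.col '' b₀) := fun h =>
    hi (Submodule.span_mono (Set.image_mono hb₀W) h)
  obtain ⟨b, -, hb₀b, hb, hbli⟩ := exists_linearIndepOn_extension
    (K := ℝ) (v := A.col) (hb₀.insert hib₀) (Set.subset_univ _)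
  have hib : i ∈ b := hb₀b (Set.mem_insert _ _)
  have htop : Submodule.span ℝ (Set.range A.col) = ⊤ := by
    apply Submodule.eq_top_of_finrank_eq
    rw [← Matrix.rank_eq_finrank_span_cols, hA, Module.finrank_fin_fun]
  have hbtop : ⊤ ≤ Submodule.span ℝ (Set.range fun x : b => A.col x) := by
    rw [← htop, Submodule.span_le, ← Set.image_univ, ← Set.image_eq_range]
    exact hb
  let B := Module.Basis.mk hbli hbtop
  have hcard : Fintype.card (Fin n) = Nat.card b := by
    rw [← Module.finrank_eq_nat_card_basis B, Module.finrank_fintype_fun_eq_card]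
  have := Fintype.ofFinite b
  rw [Nat.card_eq_fintype_card] at hcard
  let e : Fin n ≃ b := Fintype.equivOfCardEq hcard
  have hp : (e (e.symm ⟨i, hib⟩) : Fin m) = i := by simp
  have hdet : (A.submatrix id fun r => (e r : Fin m)).det ≠ 0 := by
    rw [← isUnit_iff_ne_zero, ← Matrix.isUnit_iff_isUnit_det,
      ← Matrix.linearIndependent_cols_iff_isUnit]
    exact hbli.comp e e.injective
  refine ⟨fun r => e r, e.symm ⟨i, hib⟩, hp, hdet, ?_⟩
  set p := e.symm ⟨i, hib⟩ with hpdef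
  set I : Fin n → Fin m := fun r => e r with hI
  set M := A.submatrix id I with hM
  have hupd : A.submatrix id (Function.update I p j) = M.updateCol p (A.col j) := by
    ext r s
    rcases eq_or_ne s p with h | h <;> simp [hM, h, Matrix.col_apply]
  have hself : M.updateCol p (A.col i) = M := by
    ext r s
    rcases eq_or_ne s p with rfl | h
    · simp [hM, hI, hp, Matrix.col_apply]
    · simp [h]
  -- The columns of `b₀` remain elsewhere in `M`, so putting one of them in position `p` repeats a
  -- column.
  have hzero : ∀ w ∈ Submodule.span ℝ (A.col '' b₀), (M.updateCol p w).det = 0 := by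
    intro w hw
    induction hw using Submodule.span_induction with
    | mem x hx =>
      obtain ⟨k, hk, rfl⟩ := hx
      have hkb : k ∈ b := hb₀b (Set.mem_insert_of_mem _ hk)
      have hki : k ≠ i := by
        rintro rfl
        exact hib₀ (Submodule.subset_span ⟨k, hk, rfl⟩)
      have hne : e.symm ⟨k, hkb⟩ ≠ p := by
        rw [hpdef, Ne, e.symm.injective.eq_iff]
        simpa using hki
      refine Matrix.det_zero_of_column_eq hne.symm fun r => ?_
      simp [hne, hM, hI, Matrix.col_apply]
    | zero =>
      exact Matrix.det_eq_zero_of_column_eq_zero p fun r => by simp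
    | add x y _ _ hx hy => rw [Matrix.det_updateCol_add, hx, hy, add_zero]
    | smul t x _ hx => rw [Matrix.det_updateCol_smul, hx, mul_zero]
  rw [hupd]
  intro h0
  apply hdet
  -- Expanding column `p` gives `det M = a * 0 + 0` if the exchanged minor vanishes.
  rw [← hself, hij, Matrix.det_updateCol_add, Matrix.det_updateCol_smul, h0, hzero z (hspan hz)]
  simp

/-- The two end points of a chord of `π(A)` can be exchanged in a nonzero maximal minor. -/
theorem exists_det_ne_zero_solitonPerm (A : Matrix (Fin n) (Fin m) ℝ) (hA : A.rank = n)
    {i : Fin m} (hi : solitonPerm A i ≠ i) :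
    ∃ (I : Fin n → Fin m) (p : Fin n), I p = i ∧ (A.submatrix id I).det ≠ 0 ∧
      (A.submatrix id (Function.update I p (solitonPerm A i))).det ≠ 0 := by
  have hpos : 0 < backDistance A i := by
    rw [Nat.pos_iff_ne_zero]
    intro h
    apply hi
    change stepBack i (backDistance A i) = i
    rw [h, stepBack_zero]
  obtain ⟨a, z, hz, h⟩ := mem_pred_or A i hpos
  have hW : precedingSpan A i (backDistance A i - 1) = Submodule.span ℝ
      (A.col '' {k | ∃ d, 1 ≤ d ∧ d ≤ backDistance A i - 1 ∧ stepBack i d = k}) := by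
    rw [precedingSpan]
    congr 1
    ext v
    constructor
    · rintro ⟨d, h1, h2, rfl⟩
      exact ⟨_, ⟨d, h1, h2, rfl⟩, rfl⟩
    · rintro ⟨_, ⟨d, h1, h2, rfl⟩, rfl⟩
      exact ⟨d, h1, h2, rfl⟩
  -- Minimality of the back distance: one column fewer no longer spans column `i`.
  have hni := notMem_of_lt_backDistance A i (Nat.sub_lt hpos one_pos)
  rw [hW] at hz hni
  exact exists_det_ne_zero_exchange A hA hni hz h

end ColumnExchange

/-! ### Signs of minors and Vandermonde determinants -/

section Signs

open Matrix

/-- If all nonzero maximal minors of `X` are positive, then a determinant of columns taken in any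
order has the sign of the Vandermonde determinant of increasing points attached to the columns. -/
theorem det_mul_det_vandermonde_pos {n m : ℕ} {X : Matrix (Fin n) (Fin m) ℝ}
    (hX : ∀ I : Fin n ↪o Fin m, minor X I ≠ 0 → 0 < minor X I)
    {v : Fin m → ℝ} (hv : StrictMono v) {f : Fin n → Fin m} (hf : (X.submatrix id f).det ≠ 0) :
    0 < (X.submatrix id f).det * (vandermonde (v ∘ f)).det := by
  have hinj : Function.Injective f := by
    intro r s hrs
    by_contra hne
    exact hf (det_zero_of_column_eq hne fun k => by simp [hrs])
  set σ := Tuple.sort f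
  have hmono : StrictMono (f ∘ σ) :=
    (Tuple.monotone_sort f).strictMono_of_injective (hinj.comp σ.injective)
  -- Sorting multiplies both determinants by `sign σ`, so their product is unchanged; after sorting
  -- both are positive.
  have h1 : (X.submatrix id (f ∘ σ)).det = Equiv.Perm.sign σ * (X.submatrix id f).det := by
    rw [← det_permute']
    rfl
  have h2 : (vandermonde (v ∘ f ∘ σ)).det = Equiv.Perm.sign σ * (vandermonde (v ∘ f)).det := by
    rw [← det_permute]
    rfl
  have hsq : ((Equiv.Perm.sign σ : ℤ) : ℝ) * ((Equiv.Perm.sign σ : ℤ) : ℝ) = 1 := by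
    rw [← Int.cast_mul, ← Units.val_mul, Int.units_mul_self]
    simp
  have hs : ((Equiv.Perm.sign σ : ℤ) : ℝ) ≠ 0 := left_ne_zero_of_mul_eq_one hsq
  have hX' : 0 < (X.submatrix id (f ∘ σ)).det := by
    apply hX (OrderEmbedding.ofStrictMono (f ∘ σ) hmono)
    change (X.submatrix id (f ∘ σ)).det ≠ 0
    rw [h1]
    exact mul_ne_zero hs hf
  have hV : 0 < (vandermonde (v ∘ f ∘ σ)).det := by
    rw [det_vandermonde]
    refine Finset.prod_pos fun r _ => Finset.prod_pos fun s hs => ?_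
    exact sub_pos.2 (hv (hmono (Finset.mem_Ioi.1 hs)))
  have := mul_pos hX' hV
  rw [h1, h2] at this
  calc 0 < _ := this
    _ = ((Equiv.Perm.sign σ : ℤ) : ℝ) * ((Equiv.Perm.sign σ : ℤ) : ℝ) *
        ((X.submatrix id f).det * (vandermonde (v ∘ f)).det) := by ring
    _ = _ := by rw [hsq, one_mul]

/-- Exchanging the points at two positions independently: the sign of the product of the four
Vandermonde determinants is governed by the four differences between the exchanged points. -/
theorem det_vandermonde_update_mul_nonpos {n : ℕ} (x : Fin n → ℝ) {p q : Fin n} (hpq : p < q)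
    {a b c d : ℝ} (h : (c - a) * (d - b) * (d - a) * (c - b) ≤ 0) :
    (vandermonde (Function.update (Function.update x p a) q c)).det *
      (vandermonde (Function.update (Function.update x p b) q d)).det *
      (vandermonde (Function.update (Function.update x p a) q d)).det *
      (vandermonde (Function.update (Function.update x p b) q c)).det ≤ 0 := by
  -- A single product over pairs lets the four determinants be multiplied pair by pair.
  have key : ∀ y : Fin n → ℝ, (vandermonde y).det =
      ∏ r : (Σ _ : Fin n, Fin n) with r.1 < r.2, (y r.2 - y r.1) := by
    intro y
    rw [det_vandermonde, Finset.prod_sigma']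
    congr 1
    ext r
    simp
  simp only [key, ← Finset.prod_mul_distrib]
  rw [← Finset.mul_prod_erase _ _ (a := ⟨p, q⟩) (by simpa using hpq)]
  refine mul_nonpos_of_nonpos_of_nonneg ?_ (Finset.prod_nonneg ?_)
  · simpa [hpq.ne, hpq.ne'] using h
  · rintro ⟨r, s⟩ hrs
    simp only [Finset.mem_erase, Finset.mem_filter, Finset.mem_univ, true_and, ne_eq,
      Sigma.mk.injEq, heq_eq_eq, not_and] at hrs
    obtain ⟨hne, hlt⟩ := hrs
    simp only
    -- Any pair other than `(p, q)` meets at most one changed position. Its four factors alternate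
    -- as `u, w, u, w` if they depend on the choice at `p`, and run `u, w, w, u` if they depend on
    -- the choice at `q`; an unaffected pair has `u = w`.
    have h₁ (u w : ℝ) : 0 ≤ u * w * u * w := by nlinarith [mul_self_nonneg (u * w)]
    have h₂ (u w : ℝ) : 0 ≤ u * w * w * u := by nlinarith [mul_self_nonneg (u * w)]
    simp only [Function.update_apply]
    split_ifs <;> first
      | exact h₁ _ _
      | exact h₂ _ _
      | (exfalso; grind)

end Signs

/-! ### Minors of the direct sum and crossing chords -/

section DirectSum

variable {n n' m m' : ℕ} {κ : Fin m → ℝ} {μ : Fin m' → ℝ}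

theorem append_sort_strictMono (hκ : Function.Injective κ) (hμ : Function.Injective μ)
    (hdisj : ∀ i j, κ i ≠ μ j) :
    StrictMono (Fin.append κ μ ∘ Tuple.sort (Fin.append κ μ)) :=
  (Tuple.monotone_sort _).strictMono_of_injective
    ((Fin.append_injective_iff.2 ⟨hκ, hμ, hdisj⟩).comp (Equiv.injective _))

/-- In a totally nonnegative `κ`-direct sum, the product of a minor of each summand, up to one
common factor, has the sign of the Vandermonde determinant of the attached points. -/
theorem det_mul_det_mul_vandermonde_pos {A : Matrix (Fin n) (Fin m) ℝ}
    {B : Matrix (Fin n') (Fin m') ℝ} (hκ : Function.Injective κ) (hμ : Function.Injective μ)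
    (hdisj : ∀ i j, κ i ≠ μ j) {g : GL (Fin (n + n')) ℝ}
    (hg : ∀ I : Fin (n + n') ↪o Fin (m + m'),
      minor (g.val * kappaDirectSum κ μ A B) I ≠ 0 →
        0 < minor (g.val * kappaDirectSum κ μ A B) I)
    {I : Fin n → Fin m} {J : Fin n' → Fin m'} (hI : (A.submatrix id I).det ≠ 0)
    (hJ : (B.submatrix id J).det ≠ 0) :
    0 < g.val.det * ((A.submatrix id I).det * (B.submatrix id J).det) *
      (Matrix.vandermonde (Fin.append (κ ∘ I) (μ ∘ J))).det := by
  -- The positions, after sorting by attached point, of the columns `I` of `A` followed by the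
  -- columns `J` of `B`.
  let f : Fin (n + n') → Fin (m + m') := fun k => (Tuple.sort (Fin.append κ μ)).symm
    (finSumFinEquiv (Sum.map I J (finSumFinEquiv.symm k)))
  have hblock : (kappaDirectSum κ μ A B).submatrix id f =
      (Matrix.fromBlocks (A.submatrix id I) 0 0 (B.submatrix id J)).submatrix
        finSumFinEquiv.symm finSumFinEquiv.symm := by
    ext r s
    simp only [kappaDirectSum, f, Matrix.submatrix_apply, id_eq, Equiv.apply_symm_apply,
      Equiv.symm_apply_apply]
    rcases finSumFinEquiv.symm r with r | r <;> rcases finSumFinEquiv.symm s with s | s <;> simp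
  have hdet : ((g.val * kappaDirectSum κ μ A B).submatrix id f).det =
      g.val.det * ((A.submatrix id I).det * (B.submatrix id J).det) := by
    rw [Matrix.submatrix_mul _ _ id id f Function.bijective_id, Matrix.submatrix_id_id,
      Matrix.det_mul, hblock, Matrix.det_submatrix_equiv_self, Matrix.det_fromBlocks_zero₂₁]
  have hv : (Fin.append κ μ ∘ Tuple.sort (Fin.append κ μ)) ∘ f =
      Fin.append (κ ∘ I) (μ ∘ J) := by
    funext k
    refine Fin.addCases (fun k => ?_) (fun k => ?_) k <;> simp [f]
  have hgdet : g.val.det ≠ 0 := g.det_ne_zero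
  have := det_mul_det_vandermonde_pos hg (append_sort_strictMono hκ hμ hdisj) (f := f)
    (by rw [hdet]; exact mul_ne_zero hgdet (mul_ne_zero hI hJ))
  rwa [hdet, hv] at this

/-- Crossing exchanges in the two summands are incompatible with total nonnegativity. -/
theorem not_isTotallyNonnegative_of_exchange {A : Matrix (Fin n) (Fin m) ℝ}
    {B : Matrix (Fin n') (Fin m') ℝ} (hκ : Function.Injective κ) (hμ : Function.Injective μ)
    (hdisj : ∀ i j, κ i ≠ μ j) {I : Fin n → Fin m} {p : Fin n} {i' : Fin m}
    {J : Fin n' → Fin m'} {q : Fin n'} {j' : Fin m'}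
    (hI : (A.submatrix id I).det ≠ 0) (hI' : (A.submatrix id (Function.update I p i')).det ≠ 0)
    (hJ : (B.submatrix id J).det ≠ 0) (hJ' : (B.submatrix id (Function.update J q j')).det ≠ 0)
    (h : (μ (J q) - κ (I p)) * (μ j' - κ i') * (μ j' - κ (I p)) * (μ (J q) - κ i') ≤ 0) :
    ¬ IsTotallyNonnegative (kappaDirectSum κ μ A B) := by
  rintro ⟨-, g, hg⟩
  have h1 := det_mul_det_mul_vandermonde_pos hκ hμ hdisj hg hI hJ
  have h2 := det_mul_det_mul_vandermonde_pos hκ hμ hdisj hg hI' hJ'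
  have h3 := det_mul_det_mul_vandermonde_pos hκ hμ hdisj hg hI hJ'
  have h4 := det_mul_det_mul_vandermonde_pos hκ hμ hdisj hg hI' hJ
  have hV := det_vandermonde_update_mul_nonpos (Fin.append (κ ∘ I) (μ ∘ J))
    (p := Fin.castAdd n' p) (q := Fin.natAdd n q) (Fin.lt_def.2 (by simp; omega)) h
  have hup : ∀ (k : Fin m) (l : Fin m'), Function.update (Function.update
      (Fin.append (κ ∘ I) (μ ∘ J)) (Fin.castAdd n' p) (κ k)) (Fin.natAdd n q) (μ l) =
      Fin.append (κ ∘ Function.update I p k) (μ ∘ Function.update J q l) := by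
    intro k l
    funext r
    refine Fin.addCases (fun r => ?_) (fun r => ?_) r
    · have := r.isLt.trans_le (Nat.le_add_right n q)
      simp [Function.update_apply, Fin.ext_iff, this.ne, apply_ite κ]
    · have := p.isLt.trans_le (Nat.le_add_right n r)
      simp [Function.update_apply, Fin.ext_iff, this.ne', apply_ite μ]
  simp only [hup, Function.update_eq_self] at hV
  have := mul_pos (mul_pos h1 h2) (mul_pos h3 h4)
  refine absurd this (not_lt.2 ?_)
  -- Each of the four block minors occurs in two of the products and `det g` in all four, so
  -- everything but the Vandermonde factors is a square.
  calc _ = (g.val.det ^ 2 * ((A.submatrix id I).det * (B.submatrix id J).det *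
          (A.submatrix id (Function.update I p i')).det *
          (B.submatrix id (Function.update J q j')).det)) ^ 2 * _ := by ring
    _ ≤ 0 := mul_nonpos_of_nonneg_of_nonpos (sq_nonneg _) hV

/-- Crossing means that exactly one of `c`, `d` lies between `a` and `b`, so exactly one of `(c - a)
* (c - b)` and `(d - a) * (d - b)` is negative. -/
theorem ChordsCross.mul_neg {a b c d : ℝ} (h : ChordsCross a b c d) :
    (c - a) * (d - b) * (d - a) * (c - b) < 0 := by
  rcases h with ⟨h1, h2, h3⟩ | ⟨h1, h2, h3⟩
  · exact mul_neg_of_pos_of_neg (mul_pos (mul_pos (by linarith) (by linarith)) (by linarith))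
      (by linarith)
  · exact mul_neg_of_pos_of_neg (mul_pos (mul_pos_of_neg_of_neg (by linarith) (by linarith))
      (by linarith)) (by linarith)

end DirectSum

end KPSoliton

open KPSoliton in
theorem proposition3p3
    (ℓ : ℕ) (c : ℕ → ℝ) (α₁ α₂ : ℝ) (hα : α₁ ≠ α₂)
    {n₁ m₁ n₂ m₂ : ℕ}
    (κ₁ : Fin m₁ → ℝ) (κ₂ : Fin m₂ → ℝ) (hκ₁ : StrictMono κ₁) (hκ₂ : StrictMono κ₂)
    (hroot₁ : ∀ i, KPSoliton.spectralCurve ℓ c (κ₁ i) α₁ = 0)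
    (hroot₂ : ∀ j, KPSoliton.spectralCurve ℓ c (κ₂ j) α₂ = 0)
    (A₁ : Matrix (Fin n₁) (Fin m₁) ℝ) (A₂ : Matrix (Fin n₂) (Fin m₂) ℝ)
    (hA₁ : KPSoliton.IsTotallyNonnegative A₁) (hA₂ : KPSoliton.IsTotallyNonnegative A₂)
    (hcross : ¬ KPSoliton.NonCrossingMatrices κ₁ κ₂ A₁ A₂) :
    ¬ KPSoliton.IsTotallyNonnegative (KPSoliton.kappaDirectSum κ₁ κ₂ A₁ A₂) := by
  -- A common root would determine the same value of `α`.
  have hdisj : ∀ i j, κ₁ i ≠ κ₂ j := by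
    intro i j hij
    have h1 := hroot₁ i
    have h2 := hroot₂ j
    rw [spectralCurve] at h1 h2
    rw [hij] at h1
    exact hα (by linarith)
  have key : ∀ i j, solitonPerm A₁ i ≠ i → solitonPerm A₂ j ≠ j →
      (κ₂ j - κ₁ i) * (κ₂ (solitonPerm A₂ j) - κ₁ (solitonPerm A₁ i)) *
        (κ₂ (solitonPerm A₂ j) - κ₁ i) * (κ₂ j - κ₁ (solitonPerm A₁ i)) ≤ 0 →
      ¬ IsTotallyNonnegative (kappaDirectSum κ₁ κ₂ A₁ A₂) := by
    intro i j hi hj h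
    obtain ⟨I, p, rfl, hI, hI'⟩ := exists_det_ne_zero_solitonPerm A₁ hA₁.1 hi
    obtain ⟨J, q, rfl, hJ, hJ'⟩ := exists_det_ne_zero_solitonPerm A₂ hA₂.1 hj
    exact not_isTotallyNonnegative_of_exchange hκ₁.injective hκ₂.injective hdisj hI hI' hJ hJ' h
  by_contra htnn
  refine hcross ⟨fun i j hi hj hc => ?_, fun i j hi hj hc => ?_⟩
  · exact key i j hi.ne' hj.ne' hc.mul_neg.le htnn
  -- A lower chord has `π(i)` as its left end; swapping the ends of both chords only permutes the
  -- four factors.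
  · refine key i j hi.ne hj.ne ?_ htnn
    have := hc.mul_neg.le
    linarith
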